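/- Let $N, K, L$ be positive integers with $K \le N$ and $K/2 \le L \le K$. In the $(N,K,L)$-CCDN (cache-aided content delivery network) a server holds $N$ files of $F$ bits (one unit) each; there are $K$ caches of $M \ge 0$ units each and $K$ users, and user $p$ has access to the $L$ consecutive caches $p, p+1, \dots, p+L-1$ (indices modulo $K$). In an uncoded placement each cache stores at most $MF$ bits of the files, uncoded and chosen before the requests are known. After the users have revealed a request profile $(d_1,\dots,d_K) \in \{1,\dots,N\}^K$, the server broadcasts one message, a function of all files and of the request profile, from which each user $p$, using the contents of its $L$ accessible caches, must recover file $d_p$ exactly. The pair $(R,M)$ is achievable if for every $\varepsilon>0$ and all sufficiently large $F$ there is an uncoded placement under which every request profile can be served with a message of at most $(R+\varepsilon)F$ bits. Let $R^*(M)$ be the smallest $R$ such that $(R,M)$ is achievable, and let $$R_{lb}(M)=\begin{cases} K-\Big[K-\frac{(K-L)(K-L+1)}{2K}\Big]\frac{MK}{N} & \text{if } 0\le M\le \frac NK,\\ \frac{(K-L)(K-L+1)}{2K}\Big(2-\frac{MK}{N}\Big) & \text{if } \frac NK\le M\le \frac{2N}{K},\\ 0 & \text{if } M\ge \frac{2N}{K}.\end{cases}$$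 Suppose that one of the following holds: (1) $L=K-1$; (2) $L=K-2$; (3) $L=K-3$ and $K$ is even; (4) $L=K-K/s+1$ for some positive integer $s$. Then $R^*(M)$ exists (the smallest such $R$ is attained) and $R^*(M)=R_{lb}(M)$ for every $M\ge 0$. Moreover, consider the index coding problem that arises at $M=N/K$ when each file is split into $K$ equal parts and cache $c$ stores the $c$-th part of every file: its nodes are the pairs $(p,c)$ of a user $p$ and a cache $c$ not accessible to $p$, and node $(p,c)$, which requests the $c$-th part of file $d_p$, has as side information the subfiles of all nodes $(p',c')$ for which cache $c'$ is accessible to $p$. A node $j \ne i$ interferes with node $i$ if the subfile of $j$ is not side information of $i$; a coloring of the nodes is proper if no node shares its color with a node interfering with it; and the local chromatic number is the minimum, over all proper colorings, of the maximum, over all nodes $i$, of the number of colors appearing on $i$ together with the nodes interfering with $i$. In each of the four cases the local chromatic number of this problem equals $(K-L)(K-L+1)/2$. -/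

import Mathlib

open Filter

namespace MultiaccessCaching

/-- User `p` has access to cache `c`: it is connected to the `L` consecutive caches
`p, p + 1, …, p + L - 1`, with a cyclic wrap-around. Users and caches are indexed by `Fin K`. -/
def Accesses {K : ℕ} (L : ℕ) (p c : Fin K) : Prop :=
  ∃ j : ℕ, j < L ∧ (c : ℕ) = ((p : ℕ) + j) % K

/-- The catalog: `N` files of `F` bits each. -/
abbrev Library (N F : ℕ) : Type := Fin N → Fin F → Bool

/-- An uncoded placement: each cache stores (a copy of) some of the bits of the files, a bit being
named by a file and a position in it. The placement depends neither on the values of the bits nor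
on the requests. -/
abbrev UncodedPlacement (N K F : ℕ) : Type := Fin K → Finset (Fin N × Fin F)

/-- The names of the bits that user `p` finds in the caches it has access to. -/
def accessibleBits {N K F : ℕ} (L : ℕ) (Z : UncodedPlacement N K F) (p : Fin K) :
    Set (Fin N × Fin F) :=
  {b | ∃ c : Fin K, Accesses L p c ∧ b ∈ Z c}

/-- With placement `Z` and request profile `d` (user `p` requests file `d p`), there is a delivery
scheme with a broadcast message of `ℓ` bits: an encoder, which sees the whole library, and a decoder
for each user, which sees the message and the bits in the accessible caches and always recovers the
requested file. -/
def DeliveryFeasible {N K F : ℕ} (L : ℕ) (Z : UncodedPlacement N K F) (d : Fin K → Fin N)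
    (ℓ : ℕ) : Prop :=
  ∃ (enc : Library N F → (Fin ℓ → Bool))
    (dec : (p : Fin K) → (Fin ℓ → Bool) → (accessibleBits L Z p → Bool) → (Fin F → Bool)),
    ∀ (W : Library N F) (p : Fin K), dec p (enc W) (fun b => W b.1.1 b.1.2) = W (d p)

/-- For files of `F` bits, one uncoded placement with caches of `M` units (`M * F` bits) each serves
every request profile with a message of at most `R` units (`R * F` bits). -/
def AchievableAt (N K L F : ℕ) (R M : ℝ) : Prop :=
  ∃ Z : UncodedPlacement N K F,
    (∀ c : Fin K, ((Z c).card : ℝ) ≤ M * F) ∧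
    ∀ d : Fin K → Fin N, ∃ ℓ : ℕ, (ℓ : ℝ) ≤ R * F ∧ DeliveryFeasible L Z d ℓ

/-- The rate-memory pair `(R, M)` is achievable with uncoded placement: for large file sizes `F`
the rate `R` is met up to an arbitrarily small error. -/
def Achievable (N K L : ℕ) (R M : ℝ) : Prop :=
  ∀ ε : ℝ, 0 < ε → ∀ᶠ F : ℕ in atTop, AchievableAt N K L F (R + ε) M

/-- The optimal rate-memory trade-off `R*(M)` under uncoded placement. -/
noncomputable def optimalRate (N K L : ℕ) (M : ℝ) : ℝ :=
  sInf {R : ℝ | Achievable N K L R M}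

/-- The function `R_lb(M)`. -/
noncomputable def rateLb (N K L : ℕ) (M : ℝ) : ℝ :=
  if M ≤ (N : ℝ) / K then
    (K : ℝ) - ((K : ℝ) - ((K : ℝ) - L) * ((K : ℝ) - L + 1) / (2 * K)) * (M * K / N)
  else if M ≤ 2 * (N : ℝ) / K then
    ((K : ℝ) - L) * ((K : ℝ) - L + 1) / (2 * K) * (2 - M * K / N)
  else 0

/-- An index coding problem with set of nodes `V`: node `i` requests file `i` and has the files in
`sideInfo i`, all different from file `i`, as side information. -/
structure IndexCodingProblem (V : Type) where
  sideInfo : V → Set V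
  not_mem_sideInfo : ∀ i, i ∉ sideInfo i

namespace IndexCodingProblem

variable {V : Type}

/-- Node `j` is interfering with node `i`: it is another node, whose file node `i` does not have. -/
def Interferes (I : IndexCodingProblem V) (i j : V) : Prop :=
  j ≠ i ∧ j ∉ I.sideInfo i

/-- The closed anti-outneighborhood of node `i`. -/
def closedAntiOutNbhd (I : IndexCodingProblem V) (i : V) : Set V :=
  {j | j = i ∨ I.Interferes i j}

/-- A coloring is proper if no node shares its color with a node interfering with it. -/
def IsProper {C : Type} (I : IndexCodingProblem V) (c : V → C) : Prop :=
  ∀ i j : V, I.Interferes i j → c i ≠ c j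

/-- The largest number of colors in the closed anti-outneighborhood of a node. -/
noncomputable def localColorCount [Fintype V] {C : Type} (I : IndexCodingProblem V)
    (c : V → C) : ℕ :=
  Finset.univ.sup fun i : V => (c '' I.closedAntiOutNbhd i).ncard

/-- The local chromatic number: the minimum of `localColorCount` over all proper colorings with a
positive number `k` of colors. -/
noncomputable def localChromaticNumber [Fintype V] (I : IndexCodingProblem V) : ℕ :=
  sInf {m : ℕ | ∃ (k : ℕ) (c : V → Fin k), 0 < k ∧ I.IsProper c ∧ I.localColorCount c = m}

end IndexCodingProblem

/-- The missing subfiles at `M = N / K`, where each file is split into `K` equal parts and cache `c`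
stores the `c`-th part of every file: the pair `(p, c)` stands for the `c`-th part of the file
requested by user `p`, for each cache `c` that user `p` has no access to. -/
def MissingSubfile (K L : ℕ) : Type :=
  {x : Fin K × Fin K // ¬ Accesses L x.1 x.2}

noncomputable instance (K L : ℕ) : Fintype (MissingSubfile K L) :=
  Fintype.ofInjective (Subtype.val : MissingSubfile K L → Fin K × Fin K) Subtype.val_injective

/-- The index coding problem at `M = N / K`: there is one node for each missing subfile, and the
side information of a node consists of the subfiles in caches accessible to its user. -/
def deliveryICP (K L : ℕ) : IndexCodingProblem (MissingSubfile K L) where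
  sideInfo x := {y | Accesses L x.1.1 y.1.2}
  not_mem_sideInfo x := x.2

end MultiaccessCaching

namespace MultiaccessCaching

/-! Write m = (K - L)(K - L + 1)/2.

Lower bound. If users decode one after another, each using what the earlier ones recovered, then the
message determines every requested bit missed by its requester and all earlier users, so it has at
least that many bits (`card_chainBits_le`). Averaging over cyclic chains of users and cyclic shifts
of a profile of distinct requests weights each bit by `missCount`. The weight is K² for an uncached
bit, at least m for a bit in one cache, and nonnegative otherwise. Two affine minorants in the
number of copies, summed under the memory constraint, give the two sloped pieces of `rateLb`.

Upper bound. Each file is split into a part cached once, a part cached twice and an uncached rest.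
The doubly cached part needs no message, because 2L ≥ K. The singly cached part is index coded:
given a proper coloring with at most m colors in each closed anti-outneighborhood, m Vandermonde
combinations suffice (`vandermonde_separates`).

Everything thus reduces to such a coloring, built by hand in each of the four cases. A triangle of m
nodes of pairwise distinct colors shows that m is also optimal for the local chromatic number. -/

theorem accesses_iff {K L : ℕ} (hLK : L ≤ K) (p c : Fin K) :
    Accesses L p c ↔ ((p : ℕ) ≤ c ∧ (c : ℕ) < p + L) ∨ (c : ℕ) + K < p + L := by
  have hp := p.2
  have hc := c.2
  constructor
  · rintro ⟨j, hj, h⟩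
    by_cases hlt : (p : ℕ) + j < K
    · rw [Nat.mod_eq_of_lt hlt] at h
      omega
    · rw [Nat.mod_eq_sub_mod (by omega), Nat.mod_eq_of_lt (by omega)] at h
      omega
  · rintro (h | h)
    · refine ⟨c - p, by omega, ?_⟩
      rw [Nat.mod_eq_of_lt (by omega)]
      omega
    · refine ⟨c + K - p, by omega, ?_⟩
      rw [show (p : ℕ) + (c + K - p) = c + K by omega, Nat.add_mod_right, Nat.mod_eq_of_lt hc]

/-- Delivery is feasible iff some message, together with the accessible bits, determines the
requested file of each user. -/
theorem deliveryFeasible_iff {N K F L : ℕ} {Z : UncodedPlacement N K F} {d : Fin K → Fin N}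
    {ℓ : ℕ} :
    DeliveryFeasible L Z d ℓ ↔ ∃ enc : Library N F → (Fin ℓ → Bool),
      ∀ (p : Fin K) (W W' : Library N F), enc W = enc W' →
        (∀ b ∈ accessibleBits L Z p, W b.1 b.2 = W' b.1 b.2) → W (d p) = W' (d p) := by
  classical
  constructor
  · rintro ⟨enc, dec, h⟩
    refine ⟨enc, fun p W W' hm hs => ?_⟩
    rw [← h W p, ← h W' p, hm]
    congr 1
    funext b
    exact hs b.1 b.2
  · rintro ⟨enc, h⟩
    refine ⟨enc, fun p msg side =>
      if hW : ∃ W, enc W = msg ∧ (fun b : accessibleBits L Z p => W b.1.1 b.1.2) = side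
      then hW.choose (d p) else fun _ => false, fun W p => ?_⟩
    have hW : ∃ W', enc W' = enc W ∧ (fun b : accessibleBits L Z p => W' b.1.1 b.1.2) =
      fun b : accessibleBits L Z p => W b.1.1 b.1.2 := ⟨W, rfl, rfl⟩
    beta_reduce
    rw [dif_pos hW]
    exact h p _ _ hW.choose_spec.1 fun b hb => congrFun hW.choose_spec.2 ⟨b, hb⟩

/-! ### Lower bound on the rate -/

/-- The bits of the files requested by a chain of users that are accessible neither to the user
requesting them nor to any earlier user of the chain. -/
noncomputable def chainBits {N K F : ℕ} (L : ℕ) (Z : UncodedPlacement N K F) (d : Fin K → Fin N)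
    {k : ℕ} (u : Fin k → Fin K) : Finset (Fin N × Fin F) :=
  by classical exact Finset.univ.filter fun b =>
    ∃ i, b.1 = d (u i) ∧ ∀ i' ≤ i, b ∉ accessibleBits L Z (u i')

theorem mem_chainBits {N K F L : ℕ} {Z : UncodedPlacement N K F} {d : Fin K → Fin N}
    {k : ℕ} {u : Fin k → Fin K} {b : Fin N × Fin F} :
    b ∈ chainBits L Z d u ↔ ∃ i, b.1 = d (u i) ∧ ∀ i' ≤ i, b ∉ accessibleBits L Z (u i') := by
  simp [chainBits]

/-- Set all bits outside the chain to zero. The message then determines the chain bits by induction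
along the chain: a chain bit that user `u i` can access belongs to a file requested earlier. Hence
the message takes at least 2 ^ card values. -/
theorem card_chainBits_le {N K F L : ℕ} {Z : UncodedPlacement N K F} {d : Fin K → Fin N}
    {ℓ : ℕ} (h : DeliveryFeasible L Z d ℓ) {k : ℕ} (u : Fin k → Fin K) :
    (chainBits L Z d u).card ≤ ℓ := by
  classical
  obtain ⟨enc, h⟩ := deliveryFeasible_iff.1 h
  let ext : (chainBits L Z d u → Bool) → Library N F := fun v n f =>
    if hb : (n, f) ∈ chainBits L Z d u then v ⟨(n, f), hb⟩ else false
  have hinj : Function.Injective fun v => enc (ext v) := by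
    intro v v' hv
    have key : ∀ i : Fin k, ext v (d (u i)) = ext v' (d (u i)) := by
      intro i
      induction i using WellFoundedLT.induction with
      | ind i ih =>
        refine h (u i) _ _ hv fun b hb => ?_
        by_cases hB : b ∈ chainBits L Z d u
        · obtain ⟨j, hj, hacc⟩ := mem_chainBits.1 hB
          have hji : j < i := by
            by_contra hcon
            exact hacc i (not_lt.1 hcon) hb
          rw [hj, ih j hji]
        · simp only [ext]
          rw [dif_neg hB, dif_neg hB]
    funext b
    obtain ⟨i, hi, -⟩ := mem_chainBits.1 b.2
    have h2 := congrFun (key i) b.1.2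
    rw [← hi] at h2
    simp only [ext] at h2
    rwa [dif_pos b.2, dif_pos b.2] at h2
  have hcard := Fintype.card_le_of_injective _ hinj
  simp only [Fintype.card_fun, Fintype.card_bool, Fintype.card_coe, Fintype.card_fin] at hcard
  exact (Nat.pow_le_pow_iff_right (by norm_num)).1 hcard

/-- The pairs of natural numbers with sum smaller than `n`. -/
def triangle (n : ℕ) : Finset (ℕ × ℕ) :=
  (Finset.range n ×ˢ Finset.range n).filter fun x => x.1 + x.2 < n

theorem mem_triangle {n : ℕ} {x : ℕ × ℕ} : x ∈ triangle n ↔ x.1 + x.2 < n := by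
  simp only [triangle, Finset.mem_filter, Finset.mem_product, Finset.mem_range]
  omega

theorem card_triangle (n : ℕ) : (triangle n).card = n * (n + 1) / 2 := by
  have h : triangle n = (Finset.range n).biUnion Finset.HasAntidiagonal.antidiagonal := by
    ext x
    simp [mem_triangle]
  rw [h, Finset.card_biUnion]
  · simp only [Finset.Nat.card_antidiagonal]
    have := Finset.sum_range_succ' (fun i => i) n
    rw [Finset.sum_range_id] at this
    rw [← Nat.add_zero (Finset.sum _ _), ← this, Nat.add_sub_cancel, mul_comm]
  · intro i _ j _ hij
    rw [Function.onFun, Finset.disjoint_left]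
    intro x hx hx'
    rw [Finset.HasAntidiagonal.mem_antidiagonal] at hx hx'
    exact hij (hx.symm.trans hx')

/-- The number of starting points `r` and lengths `i` such that a bit is accessible to none of the
users `r, r + 1, …, r + i`. -/
noncomputable def missCount {N K F : ℕ} [NeZero K] (L : ℕ) (Z : UncodedPlacement N K F)
    (b : Fin N × Fin F) : ℕ := by
  classical exact (Finset.univ.filter fun x : Fin K × Fin K =>
    ∀ i ≤ x.2, b ∉ accessibleBits L Z (x.1 + i)).card

theorem sum_missCount_le {N K F L : ℕ} [NeZero K] (hKN : K ≤ N) {Z : UncodedPlacement N K F}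
    {ℓ : ℕ} (h : ∀ d : Fin K → Fin N, ∃ ℓ' ≤ ℓ, DeliveryFeasible L Z d ℓ') :
    ∑ b, missCount L Z b ≤ K * N * ℓ := by
  classical
  have : NeZero N := ⟨by have := NeZero.pos K; omega⟩
  let d : Fin N → Fin K → Fin N := fun n₀ p => n₀ + Fin.castLE hKN p
  have h1 : ∑ b, missCount L Z b ≤
      (Finset.univ.sigma fun x : Fin K × Fin N =>
        chainBits L Z (d x.2) fun i : Fin K => x.1 + i).card := by
    unfold missCount
    rw [← Finset.card_sigma]
    refine Finset.card_le_card_of_injOn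
      -- For a given start r and length i, exactly one shift makes user r + i request the file of
      -- the given bit; this shift determines i in turn.
      (fun y => ⟨(y.2.1, y.1.1 - Fin.castLE hKN (y.2.1 + y.2.2)), y.1⟩) ?_ ?_
    · rintro ⟨b, r, i⟩ hy
      simp only [Finset.coe_sigma, Set.mem_sigma_iff, Finset.mem_coe, Finset.mem_univ,
        Finset.mem_filter, true_and] at hy ⊢
      exact mem_chainBits.2 ⟨i, by simp [d], hy⟩
    · rintro ⟨b, r, i⟩ - ⟨b', r', i'⟩ - hy
      simp only [Sigma.mk.injEq, Prod.mk.injEq, heq_eq_eq] at hy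
      obtain ⟨⟨rfl, h2⟩, rfl⟩ := hy
      have h3 := Fin.castLE_injective hKN (sub_right_injective h2)
      rw [add_left_cancel h3]
  refine h1.trans ?_
  rw [Finset.card_sigma]
  refine (Finset.sum_le_card_nsmul _ _ ℓ fun x _ => ?_).trans (by simp)
  obtain ⟨ℓ', hℓ, hf⟩ := h (d x.2)
  exact (card_chainBits_le hf _).trans hℓ

/-- The number of caches storing a bit. -/
def copies {N K F : ℕ} (Z : UncodedPlacement N K F) (b : Fin N × Fin F) : ℕ :=
  (Finset.univ.filter fun c => b ∈ Z c).card

theorem sum_copies {N K F : ℕ} (Z : UncodedPlacement N K F) :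
    ∑ b, copies Z b = ∑ c, (Z c).card := by
  simp only [copies, Finset.card_filter]
  rw [Finset.sum_comm]
  refine Finset.sum_congr rfl fun c _ => ?_
  rw [← Finset.card_filter, Finset.filter_mem_eq_inter, Finset.univ_inter]

theorem missCount_of_copies_eq_zero {N K F L : ℕ} [NeZero K] {Z : UncodedPlacement N K F}
    {b : Fin N × Fin F} (h : copies Z b = 0) : missCount L Z b = K * K := by
  classical
  rw [copies, Finset.card_eq_zero, Finset.filter_eq_empty_iff] at h
  rw [missCount, Finset.filter_true_of_mem]
  · simp
  · rintro x - i - ⟨c, -, hc⟩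
    exact h (Finset.mem_univ c) hc

theorem fin_val_add_cases {K : ℕ} (a b : Fin K) :
    ((a + b : Fin K) : ℕ) = a + b ∧ (a : ℕ) + b < K ∨ ((a + b : Fin K) : ℕ) + K = a + b := by
  have ha := a.2
  have hb := b.2
  rw [Fin.val_add]
  by_cases h : (a : ℕ) + b < K
  · rw [Nat.mod_eq_of_lt h]; omega
  · rw [Nat.mod_eq_sub_mod (by omega), Nat.mod_eq_of_lt (by omega)]; omega

/-- The users missing the only cache c holding the bit are c + 1, …, c + (K - L). The runs c + a +
1, …, c + a + 1 + i inside this interval are indexed by the triangle a + i < K - L. -/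
theorem le_missCount_of_copies_eq_one {N K F L : ℕ} [NeZero K] (hL : 1 ≤ L) (hLK : L ≤ K)
    {Z : UncodedPlacement N K F} {b : Fin N × Fin F} (h : copies Z b = 1) :
    (K - L) * (K - L + 1) / 2 ≤ missCount L Z b := by
  classical
  rw [copies, Finset.card_eq_one] at h
  obtain ⟨c, hc⟩ := h
  have hc' : ∀ c', b ∈ Z c' → c' = c := fun c' hb => by
    have : c' ∈ Finset.univ.filter fun c => b ∈ Z c := by simp [hb]
    rwa [hc, Finset.mem_singleton] at this
  rw [← card_triangle, missCount]
  refine Finset.card_le_card_of_injOn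
    (fun x => (c + Fin.ofNat K (x.1 + 1), Fin.ofNat K x.2)) ?_ ?_
  · rintro ⟨a, i⟩ hx
    rw [Finset.mem_coe, mem_triangle] at hx
    simp only [Finset.coe_filter, Finset.mem_univ, true_and, Set.mem_ofPred_eq] at hx ⊢
    rintro j hj ⟨c', hacc, hb⟩
    obtain rfl := hc' c' hb
    rw [accesses_iff hLK] at hacc
    have h1 := fin_val_add_cases (c' + Fin.ofNat K (a + 1)) j
    have h2 := fin_val_add_cases c' (Fin.ofNat K (a + 1))
    rw [Fin.le_def] at hj
    simp only [Fin.val_ofNat] at hj h2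
    rw [Nat.mod_eq_of_lt (by omega)] at hj h2
    have := c'.2
    omega
  · rintro ⟨a, i⟩ hx ⟨a', i'⟩ hx' heq
    rw [Finset.mem_coe, mem_triangle] at hx hx'
    simp only [Prod.mk.injEq, add_right_inj, Fin.ext_iff, Fin.val_ofNat] at heq hx hx' ⊢
    rw [Nat.mod_eq_of_lt (by omega), Nat.mod_eq_of_lt (by omega), Nat.mod_eq_of_lt (by omega),
      Nat.mod_eq_of_lt (by omega)] at heq
    omega

theorem two_mul_half (n : ℕ) : 2 * (n * (n + 1) / 2) = n * (n + 1) :=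
  Nat.mul_div_cancel' (Nat.even_mul_succ_self n).two_dvd

theorem rateLb_le {N K L : ℕ} (hKN : K ≤ N) (hL : 1 ≤ L) (hLK : L ≤ K) {R M : ℝ}
    (h : Achievable N K L R M) : rateLb N K L M ≤ R := by
  refine le_of_forall_pos_le_add fun ε hε => ?_
  obtain ⟨F, ⟨Z, hZ, hd⟩, hF⟩ := ((h ε hε).and (eventually_gt_atTop 0)).exists
  have : NeZero K := ⟨by omega⟩
  set m := (K - L) * (K - L + 1) / 2 with hm
  have hFpos : (0 : ℝ) < F := by exact_mod_cast hF
  have hKpos : (0 : ℝ) < K := by exact_mod_cast (by omega : 0 < K)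
  have hNpos : (0 : ℝ) < N := by exact_mod_cast (by omega : 0 < N)
  have hmR : ((K : ℝ) - L) * (K - L + 1) = 2 * m := by
    have := two_mul_half (K - L)
    rw [← hm] at this
    rw [← Nat.cast_sub hLK]
    exact_mod_cast this.symm
  have hmK : 2 * m ≤ K * K := by
    have := two_mul_half (K - L)
    rw [← hm] at this
    rw [this]
    exact Nat.mul_le_mul (by omega) (by omega)
  have hmKR : (2 : ℝ) * m ≤ K * K := by exact_mod_cast hmK
  have hm0 : (0 : ℝ) ≤ m := Nat.cast_nonneg m
  have hR : 0 ≤ (R + ε) * F := by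
    obtain ⟨ℓ, hℓ, -⟩ := hd fun _ => ⟨0, by omega⟩
    exact (Nat.cast_nonneg ℓ).trans hℓ
  -- The line through (0, K²) and (1, m); it is nonpositive from two copies on because 2m ≤ K². The
  -- next one is the line through (1, m) and (2, 0).
  have hw0 : ∀ b, (K : ℝ) * K - (K * K - m) * copies Z b ≤ missCount L Z b := fun b => by
    rcases h0 : copies Z b with _ | _ | k
    · rw [missCount_of_copies_eq_zero h0]; simp
    · have := le_missCount_of_copies_eq_one hL hLK h0
      rw [← hm] at this
      have : (m : ℝ) ≤ missCount L Z b := by exact_mod_cast this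
      push_cast
      linarith
    · have h1 : (0 : ℝ) ≤ missCount L Z b := Nat.cast_nonneg _
      have h2 : (0 : ℝ) ≤ k := Nat.cast_nonneg _
      push_cast
      nlinarith
  have hw1 : ∀ b, (2 : ℝ) * m - m * copies Z b ≤ missCount L Z b := fun b => by
    rcases h0 : copies Z b with _ | _ | k
    · rw [missCount_of_copies_eq_zero h0]; simpa using hmKR
    · have := le_missCount_of_copies_eq_one hL hLK h0
      rw [← hm] at this
      have : (m : ℝ) ≤ missCount L Z b := by exact_mod_cast this
      push_cast
      linarith
    · have h1 : (0 : ℝ) ≤ missCount L Z b := Nat.cast_nonneg _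
      have h2 : (0 : ℝ) ≤ k := Nat.cast_nonneg _
      push_cast
      nlinarith
  have hsum : (∑ b, (missCount L Z b : ℝ)) ≤ K * N * ((R + ε) * F) := by
    have := sum_missCount_le (L := L) (Z := Z) (ℓ := ⌊(R + ε) * F⌋₊) hKN fun d => by
      obtain ⟨ℓ, hℓ, hf⟩ := hd d
      exact ⟨ℓ, Nat.le_floor hℓ, hf⟩
    calc (∑ b, (missCount L Z b : ℝ)) ≤ ((K * N * ⌊(R + ε) * F⌋₊ : ℕ) : ℝ) := by
          exact_mod_cast this
      _ ≤ _ := by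
          push_cast
          gcongr
          exact Nat.floor_le hR
  have hcop : (∑ b, (copies Z b : ℝ)) ≤ K * (M * F) := by
    rw [← Nat.cast_sum, sum_copies, Nat.cast_sum]
    refine (Finset.sum_le_card_nsmul _ _ (M * F) fun c _ => hZ c).trans (by simp)
  have hlin : ∀ x y : ℝ, ∑ b : Fin N × Fin F, (x - y * copies Z b) =
      N * F * x - y * ∑ b, (copies Z b : ℝ) := fun x y => by
    rw [Finset.sum_sub_distrib, ← Finset.mul_sum]
    simp
  have e0 := (Finset.sum_le_sum fun b (_ : b ∈ Finset.univ) => hw0 b).trans hsum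
  have e1 := (Finset.sum_le_sum fun b (_ : b ∈ Finset.univ) => hw1 b).trans hsum
  rw [hlin] at e0 e1
  have e0' := mul_le_mul_of_nonneg_left hcop (by linarith : (0 : ℝ) ≤ K * K - m)
  have e1' := mul_le_mul_of_nonneg_left hcop hm0
  have hNKF : (0 : ℝ) < K * N * F := by positivity
  unfold rateLb
  rw [hmR]
  split_ifs
  · refine le_of_mul_le_mul_left ?_ hNKF
    have : (K : ℝ) * N * F * (K - (K - 2 * m / (2 * K)) * (M * K / N)) =
        N * F * (K * K) - (K * K - m) * (K * (M * F)) := by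
      field_simp
    linarith
  · refine le_of_mul_le_mul_left ?_ hNKF
    have : (K : ℝ) * N * F * (2 * m / (2 * K) * (2 - M * K / N)) =
        N * F * (2 * m) - m * (K * (M * F)) := by
      field_simp
    linarith
  · exact nonneg_of_mul_nonneg_left hR hFpos

/-! ### Delivery schemes and memory sharing -/

/-- With the cache contents `S c` (the same positions `x` in every file), the message `enc`
determines the requested file of each user. -/
def Resolves {N K : ℕ} {X T : Type} (L : ℕ) (S : Fin K → X → Prop) (d : Fin K → Fin N)
    (enc : (Fin N → X → Bool) → T) : Prop :=
  ∀ (p : Fin K) (W W' : Fin N → X → Bool), enc W = enc W' →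
    (∀ n x c, Accesses L p c → S c x → W n x = W' n x) → ∀ x, W (d p) x = W' (d p) x

theorem Resolves.sum {N K L : ℕ} {X₁ X₂ T₁ T₂ : Type} {S₁ : Fin K → X₁ → Prop}
    {S₂ : Fin K → X₂ → Prop} {d : Fin K → Fin N} {enc₁ : (Fin N → X₁ → Bool) → T₁}
    {enc₂ : (Fin N → X₂ → Bool) → T₂} (h₁ : Resolves L S₁ d enc₁) (h₂ : Resolves L S₂ d enc₂) :
    Resolves L (fun c => Sum.elim (S₁ c) (S₂ c)) d fun W =>
      (enc₁ fun n x => W n (Sum.inl x), enc₂ fun n x => W n (Sum.inr x)) := by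
  intro p W W' hm hs
  rw [Prod.mk.injEq] at hm
  rintro (x | x)
  · exact h₁ p _ _ hm.1 (fun n x c hc hx => hs n (Sum.inl x) c hc hx) x
  · exact h₂ p _ _ hm.2 (fun n x c hc hx => hs n (Sum.inr x) c hc hx) x

theorem resolves_uncached {N K : ℕ} (L : ℕ) (X : Type) (d : Fin K → Fin N) :
    Resolves L (fun _ (_ : X) => False) d fun W (y : Fin K × X) => W (d y.1) y.2 :=
  fun p _ _ hm _ x => congrFun hm (p, x)

/-- Cache c holds parts 2c and 2c + 1 modulo K, so L consecutive caches hold 2L ≥ K cyclically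
consecutive parts, hence all of them. -/
theorem resolves_doublyCached {N K : ℕ} {L : ℕ} (hL : K ≤ 2 * L) (q : ℕ)
    (d : Fin K → Fin N) :
    Resolves L (fun c (x : Fin K × Fin q) => (x.1 : ℕ) = 2 * c % K ∨ (x.1 : ℕ) = (2 * c + 1) % K)
      d fun _ => () := by
  rintro p W W' - hs ⟨k, x⟩
  have hk := k.2
  have hp := p.2
  obtain ⟨y, hy, hyk⟩ : ∃ y, y < 2 * L ∧ (2 * p + y) % K = k := by
    refine ⟨(k + 2 * K - 2 * p) % K, (Nat.mod_lt _ (by omega)).trans_le hL, ?_⟩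
    rw [Nat.add_mod_mod, show 2 * (p : ℕ) + (k + 2 * K - 2 * p) = k + K * 2 by omega,
      Nat.add_mul_mod_self_left, Nat.mod_eq_of_lt hk]
  refine hs _ _ ⟨(p + y / 2) % K, Nat.mod_lt _ (by omega)⟩ ⟨y / 2, by omega, rfl⟩ ?_
  have h2 : ∀ r, (2 * ((p + y / 2) % K) + r) % K = (2 * p + (2 * (y / 2) + r)) % K := fun r => by
    rw [Nat.add_mod, Nat.mul_mod, Nat.mod_mod, ← Nat.mul_mod, ← Nat.add_mod]
    congr 1
    ring
  rcases Nat.mod_two_eq_zero_or_one y with hpar | hpar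
  · left
    have := h2 0
    rw [Nat.add_zero] at this
    simp only
    rw [this, ← hyk]
    congr 1
    omega
  · right
    simp only
    rw [h2, ← hyk]
    congr 1
    omega

/-- The power sums of `e` vanish against every polynomial of degree below m. One that vanishes at
all colors of `s` except that of `y₀` leaves only the term of `y₀`. -/
theorem vandermonde_separates {V 𝔽 C : Type} [Fintype V] [Field 𝔽] {m : ℕ} {α : C → 𝔽}
    (hα : Function.Injective α) (col : V → C) (e : V → 𝔽)
    (h : ∀ j < m, ∑ y, e y * α (col y) ^ j = 0) (s : Finset C) (hs : s.card ≤ m) (y₀ : V)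
    (hy₀ : col y₀ ∈ s) (hmem : ∀ y, e y ≠ 0 → col y ∈ s)
    (hsep : ∀ y, e y ≠ 0 → col y = col y₀ → y = y₀) : e y₀ = 0 := by
  classical
  let f : Polynomial 𝔽 := ∏ γ ∈ s.erase (col y₀), (Polynomial.X - Polynomial.C (α γ))
  have hdeg : f.natDegree < m := by
    have : 0 < s.card := Finset.card_pos.2 ⟨_, hy₀⟩
    rw [Polynomial.natDegree_prod_of_monic _ _ fun _ _ => Polynomial.monic_X_sub_C _]
    simp only [Polynomial.natDegree_X_sub_C, Finset.sum_const, smul_eq_mul, mul_one,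
      Finset.card_erase_of_mem hy₀]
    omega
  have hsum : ∑ y, e y * f.eval (α (col y)) = 0 := by
    simp only [Polynomial.eval_eq_sum_range' hdeg, Finset.mul_sum]
    rw [Finset.sum_comm]
    refine Finset.sum_eq_zero fun j hj => ?_
    have := h j (Finset.mem_range.1 hj)
    calc ∑ y, e y * (f.coeff j * α (col y) ^ j)
        = f.coeff j * ∑ y, e y * α (col y) ^ j := by
          rw [Finset.mul_sum]
          exact Finset.sum_congr rfl fun y _ => by ring
      _ = 0 := by rw [this, mul_zero]
  have heval : ∀ x, f.eval x = ∏ γ ∈ s.erase (col y₀), (x - α γ) := fun x => by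
    simp [f, Polynomial.eval_prod]
  rw [Finset.sum_eq_single y₀] at hsum
  · refine (mul_eq_zero.1 hsum).resolve_right ?_
    rw [heval]
    refine Finset.prod_ne_zero_iff.2 ?_
    intro γ hγ h0
    exact (Finset.mem_erase.1 hγ).1 (hα (sub_eq_zero.1 h0)).symm
  · intro y _ hy
    by_cases hey : e y = 0
    · rw [hey, zero_mul]
    · rw [heval, Finset.prod_eq_zero (i := col y), mul_zero]
      · exact Finset.mem_erase.2 ⟨fun hc => hy (hsep y hey hc), hmem y hey⟩
      · exact sub_self _
  · exact fun hy => (hy (Finset.mem_univ _)).elim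

theorem mem_closedAntiOutNbhd {K L : ℕ} {x y : MissingSubfile K L} :
    y ∈ (deliveryICP K L).closedAntiOutNbhd x ↔ ¬ Accesses L x.1.1 y.1.2 := by
  constructor
  · rintro (rfl | h)
    · exact y.2
    · exact h.2
  · intro h
    by_cases hxy : y = x
    · exact Or.inl hxy
    · exact Or.inr ⟨hxy, h⟩

/-- For two libraries with the same message and side information, the differences of the subfiles
are supported on the closed anti-outneighborhood of the wanted node. Properness makes that node's
color unique there. -/
theorem resolves_coded {N K L m u b : ℕ} {C 𝔽 : Type} [Field 𝔽] {col : MissingSubfile K L → C}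
    (hcol : (deliveryICP K L).IsProper col)
    (hloc : ∀ x, (col '' (deliveryICP K L).closedAntiOutNbhd x).ncard ≤ m)
    {α : C → 𝔽} (hα : Function.Injective α) (φ : (Fin b → Bool) ≃ 𝔽) (d : Fin K → Fin N) :
    Resolves L (fun c (x : Fin K × Fin u × Fin b) => x.1 = c) d fun W (y : Fin u × Fin m) =>
      ∑ z : MissingSubfile K L, φ (fun k => W (d z.1.1) (z.1.2, y.1, k)) * α (col z) ^ (y.2 : ℕ) := by
  intro p W W' hm hs
  rintro ⟨c, i, k⟩
  by_cases hc : Accesses L p c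
  · exact hs _ _ c hc rfl
  let x : MissingSubfile K L := ⟨(p, c), hc⟩
  let e : MissingSubfile K L → 𝔽 := fun z =>
    φ (fun k => W (d z.1.1) (z.1.2, i, k)) - φ (fun k => W' (d z.1.1) (z.1.2, i, k))
  have hne : ∀ z, e z ≠ 0 → z ∈ (deliveryICP K L).closedAntiOutNbhd x := by
    intro z hz
    rw [mem_closedAntiOutNbhd]
    intro hacc
    apply hz
    rw [sub_eq_zero]
    congr 1
    funext k
    exact hs _ _ z.1.2 hacc rfl
  have hfin : (col '' (deliveryICP K L).closedAntiOutNbhd x).Finite :=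
    (Set.toFinite _).image col
  have hx : x ∈ (deliveryICP K L).closedAntiOutNbhd x := Or.inl rfl
  have h0 : e x = 0 := by
    refine vandermonde_separates (m := m) hα col e ?_ hfin.toFinset ?_ x ?_ ?_ ?_
    · intro j hj
      have := congrFun hm (i, ⟨j, hj⟩)
      simp only [e, sub_mul, Finset.sum_sub_distrib, sub_eq_zero]
      exact this
    · rw [← Set.ncard_eq_toFinset_card _ hfin]
      exact hloc x
    · rw [Set.Finite.mem_toFinset]
      exact ⟨x, hx, rfl⟩
    · intro z hz
      rw [Set.Finite.mem_toFinset]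
      exact ⟨z, hne z hz, rfl⟩
    · intro z hz hzc
      by_contra hzx
      rcases hne z hz with h | h
      · exact hzx h
      · exact hcol x z h hzc.symm
  exact congrFun (φ.injective (sub_eq_zero.1 h0)) k

/-- The placement in which cache `c` stores, of every file, the positions `x` with `S c x`. -/
noncomputable def symmetricPlacement (N : ℕ) {K F : ℕ} {X : Type} (S : Fin K → X → Prop)
    (e : Fin F ≃ X) : UncodedPlacement N K F :=
  fun c => by classical exact Finset.univ.filter fun b => S c (e b.2)

theorem Resolves.deliveryFeasible {N K L F ℓ : ℕ} {X T : Type} [Fintype T]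
    {S : Fin K → X → Prop} {d : Fin K → Fin N} {enc : (Fin N → X → Bool) → T}
    (h : Resolves L S d enc) (hT : Fintype.card T ≤ 2 ^ ℓ) (e : Fin F ≃ X) :
    DeliveryFeasible L (symmetricPlacement N S e) d ℓ := by
  classical
  obtain ⟨g⟩ : Nonempty (T ↪ (Fin ℓ → Bool)) :=
    Function.Embedding.nonempty_of_card_le (by simpa using hT)
  refine deliveryFeasible_iff.2 ⟨fun W => g (enc fun n x => W n (e.symm x)),
    fun p W W' hm hs => ?_⟩
  funext f
  have := h p _ _ (g.injective hm) (fun n x c hc hx =>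
    hs (n, e.symm x) ⟨c, hc, by simpa [symmetricPlacement] using hx⟩) (e f)
  simpa using this

theorem achievableAt_of_split {N K L m u b q F : ℕ} (hK : 0 < K) (hL : K ≤ 2 * L) {C 𝔽 : Type}
    [Field 𝔽] [Fintype 𝔽] (h𝔽 : Fintype.card 𝔽 = 2 ^ b) {col : MissingSubfile K L → C}
    (hcol : (deliveryICP K L).IsProper col)
    (hloc : ∀ x, (col '' (deliveryICP K L).closedAntiOutNbhd x).ncard ≤ m)
    {α : C → 𝔽} (hα : Function.Injective α) (hF : K * (u * b + q) ≤ F) {R M : ℝ}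
    (hM : (N : ℝ) * (u * b + 2 * q) ≤ M * F)
    (hR : (m : ℝ) * (u * b) + K * (F - K * (u * b + q)) ≤ R * F) :
    AchievableAt N K L F R M := by
  classical
  obtain ⟨r, rfl⟩ := Nat.exists_eq_add_of_le hF
  let φ : (Fin b → Bool) ≃ 𝔽 := Fintype.equivOfCardEq (by simp [h𝔽])
  let S : Fin K → (Fin K × Fin u × Fin b) ⊕ ((Fin K × Fin q) ⊕ Fin r) → Prop := fun c =>
    Sum.elim (fun x => x.1 = c) (Sum.elim
      (fun x => (x.1 : ℕ) = 2 * c % K ∨ (x.1 : ℕ) = (2 * c + 1) % K) fun _ => False)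
  let e : Fin (K * (u * b + q) + r) ≃ (Fin K × Fin u × Fin b) ⊕ ((Fin K × Fin q) ⊕ Fin r) :=
    Fintype.equivOfCardEq (by simp; ring)
  refine ⟨symmetricPlacement N S e, fun c => le_trans ?_ hM, fun d =>
    ⟨m * (u * b) + K * r, ?_, ?_⟩⟩
  · let g : Fin N × ((Fin u × Fin b) ⊕ (Bool × Fin q)) → Fin N × Fin (K * (u * b + q) + r) :=
      fun y => (y.1, e.symm (y.2.elim (fun z => Sum.inl (c, z))
        fun z => Sum.inr (Sum.inl (⟨(2 * c + z.1.toNat) % K, Nat.mod_lt _ hK⟩, z.2))))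
    have hsub : symmetricPlacement N S e c ⊆ Finset.univ.image g := by
      rintro ⟨n, f⟩ hf
      have hf' : S c (e f) := by simpa [symmetricPlacement] using hf
      rw [Finset.mem_image]
      rcases hx : e f with x | x | x
      · rw [hx] at hf'
        obtain ⟨k, y⟩ := x
        obtain rfl : k = c := hf'
        exact ⟨(n, Sum.inl y), Finset.mem_univ _, by simp [g, ← hx]⟩
      · rw [hx] at hf'
        obtain ⟨k, y⟩ := x
        rcases hf' with h | h
        · refine ⟨(n, Sum.inr (false, y)), Finset.mem_univ _, ?_⟩
          have hk : (⟨(2 * c + false.toNat) % K, Nat.mod_lt _ hK⟩ : Fin K) = k := Fin.ext h.symm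
          simp only [g, Sum.elim_inr, hk, ← hx, Equiv.symm_apply_apply]
        · refine ⟨(n, Sum.inr (true, y)), Finset.mem_univ _, ?_⟩
          have hk : (⟨(2 * c + true.toNat) % K, Nat.mod_lt _ hK⟩ : Fin K) = k := Fin.ext h.symm
          simp only [g, Sum.elim_inr, hk, ← hx, Equiv.symm_apply_apply]
      · rw [hx] at hf'
        exact hf'.elim
    have := (Finset.card_le_card hsub).trans Finset.card_image_le
    have : (symmetricPlacement N S e c).card ≤ N * (u * b + 2 * q) := by simpa using this
    exact_mod_cast this
  · push_cast at hR ⊢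
    linarith
  · refine (((resolves_coded hcol hloc hα φ d).sum
      ((resolves_doublyCached hL q d).sum (resolves_uncached L (Fin r) d)))).deliveryFeasible
      ?_ e
    simp only [Fintype.card_prod, Fintype.card_fun, h𝔽, Fintype.card_fin, Fintype.card_bool,
      Fintype.card_unit, one_mul]
    rw [← pow_mul, ← pow_add]
    exact Nat.pow_le_pow_right (by norm_num) (by apply le_of_eq; ring)

theorem achievable_rateLb {N K L : ℕ} (hKN : K ≤ N) (hL1 : 1 ≤ L) (hLK : L ≤ K)
    (hL : K ≤ 2 * L) {C : Type} [Finite C] {col : MissingSubfile K L → C}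
    (hcol : (deliveryICP K L).IsProper col)
    (hloc : ∀ x, (col '' (deliveryICP K L).closedAntiOutNbhd x).ncard ≤
      (K - L) * (K - L + 1) / 2) {M : ℝ} (hM : 0 ≤ M) :
    Achievable N K L (rateLb N K L M) M := by
  have := Fintype.ofFinite C
  obtain ⟨b, hb, hbC⟩ : ∃ b, b ≠ 0 ∧ Fintype.card C ≤ 2 ^ b :=
    ⟨Fintype.card C + 1, by omega, (Nat.lt_two_pow_self.trans (Nat.pow_lt_pow_succ one_lt_two)).le⟩
  have : Fintype (GaloisField 2 b) := Fintype.ofFinite _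
  have h𝔽 : Fintype.card (GaloisField 2 b) = 2 ^ b := by
    rw [← Nat.card_eq_fintype_card, GaloisField.card 2 b hb]
  obtain ⟨α⟩ : Nonempty (C ↪ GaloisField 2 b) :=
    Function.Embedding.nonempty_of_card_le (by rwa [h𝔽])
  have hmR : ((K : ℝ) - L) * (K - L + 1) = 2 * ((K - L) * (K - L + 1) / 2 : ℕ) := by
    have := two_mul_half (K - L)
    rw [← Nat.cast_sub hLK]
    exact_mod_cast this.symm
  generalize (K - L) * (K - L + 1) / 2 = m at *
  have hK : (0 : ℝ) < K := by exact_mod_cast (by omega : 0 < K)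
  have hN : (0 : ℝ) < N := by exact_mod_cast (by omega : 0 < N)
  have hbR : (0 : ℝ) < b := by exact_mod_cast Nat.pos_of_ne_zero hb
  have hm0 : (0 : ℝ) ≤ m := Nat.cast_nonneg m
  intro ε hε
  filter_upwards [eventually_ge_atTop ⌈(K : ℝ) * K * (b + 1) / ε⌉₊] with F hF
  have hFε : (K : ℝ) * K * (b + 1) ≤ ε * F := by
    have := Nat.ceil_le.1 hF
    rw [div_le_iff₀ hε] at this
    linarith
  have hF0 : (0 : ℝ) ≤ F := Nat.cast_nonneg F
  have main : ∀ x y : ℝ, 0 ≤ x → 0 ≤ y → K * (x + y) ≤ F → N * (x + 2 * y) ≤ M * F →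
      m * x + K * (F - K * (x + y)) ≤ rateLb N K L M * F →
      AchievableAt N K L F (rateLb N K L M + ε) M := by
    intro x y hx hy h1 h2 h3
    have hu1 : (⌊x / b⌋₊ : ℝ) * b ≤ x := by
      have := Nat.floor_le (div_nonneg hx hbR.le)
      rwa [le_div_iff₀ hbR] at this
    have hu2 : x ≤ (⌊x / b⌋₊ : ℝ) * b + b := by
      have := (Nat.lt_floor_add_one (x / b)).le
      rw [div_le_iff₀ hbR] at this
      linarith
    have hq1 := Nat.floor_le hy
    have hq2 := (Nat.lt_floor_add_one y).le
    refine achievableAt_of_split (m := m) (u := ⌊x / b⌋₊) (b := b) (q := ⌊y⌋₊) (by omega) hL h𝔽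
      hcol hloc α.injective ?_ ?_ ?_
    · have : (K : ℝ) * (⌊x / b⌋₊ * b + ⌊y⌋₊) ≤ F := le_trans (by gcongr) h1
      exact_mod_cast this
    · exact le_trans (by gcongr) h2
    · have e1 : (m : ℝ) * (⌊x / b⌋₊ * b) ≤ m * x := by gcongr
      have e2 : (K : ℝ) * (K * (x + y)) ≤ K * (K * ((⌊x / b⌋₊ * b + ⌊y⌋₊) + (b + 1))) := by
        refine mul_le_mul_of_nonneg_left (mul_le_mul_of_nonneg_left ?_ hK.le) hK.le
        linarith
      linarith
  have hrate : rateLb N K L M = if M ≤ (N : ℝ) / K then K - (K - m / K) * (M * K / N)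
      else if M ≤ 2 * (N : ℝ) / K then m / K * (2 - M * K / N) else 0 := by
    rw [rateLb, hmR, mul_div_mul_left _ _ two_ne_zero]
  split_ifs at hrate with hM1 hM2
  · refine main (M * F / N) 0 (by positivity) le_rfl ?_ (le_of_eq ?_) (le_of_eq ?_)
    · rw [le_div_iff₀ hK] at hM1
      calc (K : ℝ) * (M * F / N + 0) = M * K * F / N := by ring
        _ ≤ N * F / N := by gcongr
        _ = F := by field_simp
    · field_simp
      ring
    · rw [hrate]
      field_simp
      ring
  · rw [not_le, div_lt_iff₀ hK] at hM1
    rw [le_div_iff₀ hK] at hM2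
    -- The solution of K(x + y) = F and N(x + 2y) = MF: no uncached rest, and full caches.
    refine main (2 * F / K - M * F / N) (M * F / N - F / K) ?_ ?_ (le_of_eq ?_) (le_of_eq ?_)
      (le_of_eq ?_)
    · have : 2 * F / K - M * F / N = F * (2 * N - M * K) / (K * N) := by
        field_simp
      rw [this]
      exact div_nonneg (mul_nonneg hF0 (by linarith)) (by positivity)
    · have : M * F / N - F / K = F * (M * K - N) / (K * N) := by
        field_simp
      rw [this]
      exact div_nonneg (mul_nonneg hF0 (by linarith)) (by positivity)
    · field_simp
      ring
    · field_simp
      ring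
    · rw [hrate]
      field_simp
      ring
  · rw [not_le, div_lt_iff₀ hK] at hM2
    refine main 0 (F / K) le_rfl (by positivity) (le_of_eq (by field_simp; ring)) ?_
      (le_of_eq (by rw [hrate]; field_simp; ring))
    calc (N : ℝ) * (0 + 2 * (F / K)) = 2 * N * F / K := by ring
      _ ≤ M * K * F / K := by gcongr
      _ = M * F := by field_simp

/-! ### The local chromatic number -/

/-- Take the nodes (i, K - 1 - a) with i + a < K - L. Of two of them, the one with the larger user
interferes with the other (either one if the users agree), so all colors differ; and all these nodes
lie in the neighborhood of (0, K - 1). -/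
theorem half_le_localColorCount {K L : ℕ} (hL : 1 ≤ L) (hLK : L ≤ K) {C : Type}
    {col : MissingSubfile K L → C} (hcol : (deliveryICP K L).IsProper col) :
    (K - L) * (K - L + 1) / 2 ≤ (deliveryICP K L).localColorCount col := by
  classical
  rcases Nat.eq_zero_or_pos (K - L) with h0 | hpos
  · simp [h0]
  have hnode : ∀ i a : ℕ, i + a < K - L → ∀ (hi : i < K) (ha : K - 1 - a < K),
      ¬ Accesses L (⟨i, hi⟩ : Fin K) ⟨K - 1 - a, ha⟩ := fun i a h hi ha => by
    rw [accesses_iff hLK]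
    dsimp only
    omega
  let node : triangle (K - L) → MissingSubfile K L := fun x =>
    ⟨(⟨x.1.1, by have := mem_triangle.1 x.2; omega⟩, ⟨K - 1 - x.1.2, by omega⟩),
      hnode _ _ (mem_triangle.1 x.2) _ _⟩
  let x₀ : MissingSubfile K L :=
    ⟨(⟨0, by omega⟩, ⟨K - 1 - 0, by omega⟩), hnode 0 0 (by omega) _ _⟩
  have hlt : ∀ x y : triangle (K - L), x ≠ y → x.1.1 ≤ y.1.1 → col (node x) ≠ col (node y) := by
    intro x y hxy hle
    have hx := mem_triangle.1 x.2
    have hy := mem_triangle.1 y.2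
    refine hcol _ _ ⟨fun h => hxy ?_, ?_⟩
    · have h1 : y.1.1 = x.1.1 := congrArg (fun z : MissingSubfile K L => (z.1.1 : ℕ)) h
      have h2 : K - 1 - y.1.2 = K - 1 - x.1.2 :=
        congrArg (fun z : MissingSubfile K L => (z.1.2 : ℕ)) h
      refine Subtype.ext (Prod.ext h1.symm ?_)
      omega
    · exact hnode x.1.1 y.1.2 (by omega) _ _
  have hinj : Function.Injective fun x => col (node x) := by
    intro x y hxy
    by_contra hne
    rcases le_total x.1.1 y.1.1 with h | h
    · exact hlt x y hne h hxy
    · exact hlt y x (Ne.symm hne) h hxy.symm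
  have hfin : (col '' (deliveryICP K L).closedAntiOutNbhd x₀).Finite := (Set.toFinite _).image col
  calc (K - L) * (K - L + 1) / 2 = (Set.range fun x => col (node x)).ncard := by
        rw [← card_triangle, ← Set.image_univ, Set.ncard_image_of_injective _ hinj, Set.ncard_univ,
          Nat.card_eq_fintype_card, Fintype.card_coe]
    _ ≤ (col '' (deliveryICP K L).closedAntiOutNbhd x₀).ncard := by
        refine Set.ncard_le_ncard ?_ hfin
        rintro _ ⟨x, rfl⟩
        refine ⟨node x, mem_closedAntiOutNbhd.2 ?_, rfl⟩
        have hx := mem_triangle.1 x.2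
        exact hnode 0 x.1.2 (by omega) _ _
    _ ≤ _ := Finset.le_sup (f := fun i =>
        (col '' (deliveryICP K L).closedAntiOutNbhd i).ncard) (Finset.mem_univ x₀)

theorem localChromaticNumber_eq {K L : ℕ} (hL : 1 ≤ L) (hLK : L ≤ K) {C : Type} [Finite C]
    [Nonempty C] {col : MissingSubfile K L → C} (hcol : (deliveryICP K L).IsProper col)
    (hloc : ∀ x, (col '' (deliveryICP K L).closedAntiOutNbhd x).ncard ≤
      (K - L) * (K - L + 1) / 2) :
    (deliveryICP K L).localChromaticNumber = (K - L) * (K - L + 1) / 2 := by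
  classical
  have := Fintype.ofFinite C
  let e := Fintype.equivFin C
  have hmem : (K - L) * (K - L + 1) / 2 ∈ {m : ℕ | ∃ (k : ℕ) (c : MissingSubfile K L → Fin k),
      0 < k ∧ (deliveryICP K L).IsProper c ∧ (deliveryICP K L).localColorCount c = m} := by
    have hproper : (deliveryICP K L).IsProper fun x => e (col x) :=
      fun i j h heq => hcol i j h (e.injective heq)
    refine ⟨Fintype.card C, fun x => e (col x), Fintype.card_pos, hproper,
      le_antisymm (Finset.sup_le fun x _ => ?_) (half_le_localColorCount hL hLK hproper)⟩
    have : (fun x => e (col x)) '' (deliveryICP K L).closedAntiOutNbhd x =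
        e '' (col '' (deliveryICP K L).closedAntiOutNbhd x) := by
      rw [Set.image_image]
    rw [this, Set.ncard_image_of_injective _ e.injective]
    exact hloc x
  refine le_antisymm (Nat.sInf_le hmem) ?_
  obtain ⟨k, c, -, hc, h⟩ := Nat.sInf_mem ⟨_, hmem⟩
  rw [IndexCodingProblem.localChromaticNumber, ← h]
  exact half_le_localColorCount hL hLK hc

/-! ### Tight colorings in the four cases -/

/-- The cyclic distance, from `1` to `K`, from a cache `c` up to a user `p`. -/
def gap {K : ℕ} (p c : Fin K) : ℕ := if c < p then p - c else p + K - c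

theorem gap_spec {K : ℕ} (p c : Fin K) :
    (1 ≤ gap p c ∧ gap p c ≤ K) ∧ ((p : ℕ) = c + gap p c ∨ (p : ℕ) + K = c + gap p c) := by
  have := c.2
  have := p.2
  unfold gap
  split_ifs with h <;> rw [Fin.lt_def] at h <;> omega

theorem not_accesses_iff {K L : ℕ} (hL : 1 ≤ L) (hLK : L ≤ K) (p c : Fin K) :
    ¬ Accesses L p c ↔ gap p c ≤ K - L := by
  have := gap_spec p c
  have := c.2
  have := p.2
  rw [accesses_iff hLK]
  omega

/-- There is a proper coloring with at most `(K - L) * (K - L + 1) / 2` colors in each closed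
anti-outneighborhood. -/
def HasTightColoring (K L : ℕ) : Prop :=
  ∃ (C : Type) (_ : Finite C) (_ : Nonempty C) (col : MissingSubfile K L → C),
    (deliveryICP K L).IsProper col ∧
      ∀ x, (col '' (deliveryICP K L).closedAntiOutNbhd x).ncard ≤ (K - L) * (K - L + 1) / 2

/-- Neighborhoods depend only on the user of the node, so one set of colors per user bounds them
all. -/
theorem hasTightColoring_of_gap {K L : ℕ} (hL : 1 ≤ L) (hLK : L ≤ K) {C : Type} [Finite C]
    [Nonempty C] (col : Fin K → Fin K → C)
    (hproper : ∀ p c p' c', gap p c ≤ K - L → gap p' c' ≤ K - L → gap p c' ≤ K - L →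
      col p c = col p' c' → p = p' ∧ c = c')
    (s : Fin K → Finset C) (hs : ∀ p, (s p).card ≤ (K - L) * (K - L + 1) / 2)
    (hmem : ∀ p p' c', gap p' c' ≤ K - L → gap p c' ≤ K - L → col p' c' ∈ s p) :
    HasTightColoring K L := by
  refine ⟨C, ‹_›, ‹_›, fun x => col x.1.1 x.1.2, ?_, fun x => ?_⟩
  · rintro x y ⟨hne, hacc⟩ heq
    obtain ⟨h1, h2⟩ := hproper _ _ _ _ ((not_accesses_iff hL hLK _ _).1 x.2)
      ((not_accesses_iff hL hLK _ _).1 y.2) ((not_accesses_iff hL hLK _ _).1 hacc) heq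
    exact hne (Subtype.ext (Prod.ext h1 h2)).symm
  · refine le_trans ?_ (hs x.1.1)
    rw [← Set.ncard_coe_finset]
    refine Set.ncard_le_ncard ?_ (Finset.finite_toSet _)
    rintro _ ⟨y, hy, rfl⟩
    exact hmem _ _ _ ((not_accesses_iff hL hLK _ _).1 y.2)
      ((not_accesses_iff hL hLK _ _).1 (mem_closedAntiOutNbhd.1 hy))

/-- The cyclic predecessor. -/
def cpred {K : ℕ} (c : Fin K) : Fin K :=
  ⟨if (c : ℕ) = 0 then K - 1 else c - 1, by have := c.2; split_ifs <;> omega⟩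

theorem cpred_spec {K : ℕ} (c : Fin K) :
    (c : ℕ) = 0 ∧ (cpred c : ℕ) + 1 = K ∨ (cpred c : ℕ) + 1 = c := by
  have := c.2
  unfold cpred
  dsimp only
  split_ifs <;> omega

theorem hasTightColoring_one {K L : ℕ} (hL : 1 ≤ L) (h : L + 1 = K) : HasTightColoring K L := by
  have hn : K - L = 1 := by omega
  refine hasTightColoring_of_gap hL (by omega) (fun _ _ => ()) ?_ (fun _ => {()}) ?_ ?_
  · intro p c p' c' h1 h2 h3 _
    have := gap_spec p c
    have := gap_spec p' c'
    have := gap_spec p c'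
    have := c.2
    have := c'.2
    have := p.2
    have := p'.2
    rw [Fin.ext_iff, Fin.ext_iff]
    omega
  · intro p
    simp [hn]
  · simp

/-- Color γ joins (γ + 1, γ) and (γ + 3, γ + 1), whose users each access the other's cache. User p
sees only the colors p - 1, p - 2, p - 3. -/
theorem hasTightColoring_two {K L : ℕ} (hL : 2 ≤ L) (h : L + 2 = K) : HasTightColoring K L := by
  have hn : K - L = 2 := by omega
  have : Nonempty (Fin K) := ⟨⟨0, by omega⟩⟩
  refine hasTightColoring_of_gap (by omega) (by omega)
    (fun p c => if gap p c = 1 then c else cpred c) ?_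
    (fun p => {cpred p, cpred (cpred p), cpred (cpred (cpred p))}) ?_ ?_
  · intro p c p' c' h1 h2 h3 heq
    have := gap_spec p c
    have := gap_spec p' c'
    have := gap_spec p c'
    have := c.2
    have := c'.2
    have := p.2
    have := p'.2
    have := cpred_spec c
    have := cpred_spec c'
    rw [Fin.ext_iff, Fin.ext_iff]
    split_ifs at heq <;> rw [Fin.ext_iff] at heq <;> omega
  · intro p
    rw [hn]
    exact Finset.card_le_three
  · intro p p' c' h2 h3
    have := gap_spec p' c'
    have := gap_spec p c'
    have := c'.2
    have := p.2
    have := p'.2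
    have := cpred_spec c'
    have := cpred_spec p
    have := cpred_spec (cpred p)
    have := cpred_spec (cpred (cpred p))
    simp only [Finset.mem_insert, Finset.mem_singleton, Fin.ext_iff]
    split_ifs <;> omega

/-- Gaps 1 and 3 are paired, giving four colors per user; gap 2 needs two more, the parities of the
cache. Evenness of K keeps the parity consistent around the cycle. -/
theorem hasTightColoring_three {K L : ℕ} (hL : 3 ≤ L) (h : L + 3 = K) (hK : Even K) :
    HasTightColoring K L := by
  have hn : K - L = 3 := by omega
  have hK2 := Nat.even_iff.1 hK
  refine hasTightColoring_of_gap (C := Fin K ⊕ Fin 2) (by omega) (by omega)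
    (fun p c => if gap p c = 1 then Sum.inl c else if gap p c = 3 then Sum.inl (cpred c)
      else Sum.inr (Fin.ofNat 2 c)) ?_
    (fun p => ({cpred p, cpred (cpred p), cpred (cpred (cpred p)),
      cpred (cpred (cpred (cpred p)))} : Finset (Fin K)).disjSum Finset.univ) ?_ ?_
  · intro p c p' c' h1 h2 h3 heq
    have := gap_spec p c
    have := gap_spec p' c'
    have := gap_spec p c'
    have := c.2
    have := c'.2
    have := p.2
    have := p'.2
    have := cpred_spec c
    have := cpred_spec c'
    rw [Fin.ext_iff, Fin.ext_iff]
    split_ifs at heq <;>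
      simp only [Sum.inl.injEq, Sum.inr.injEq, Fin.ext_iff, Fin.val_ofNat] at heq <;> omega
  · intro p
    rw [hn, Finset.card_disjSum]
    have : _ ≤ 4 := Finset.card_le_four (a := cpred p) (b := cpred (cpred p))
      (c := cpred (cpred (cpred p))) (d := cpred (cpred (cpred (cpred p))))
    simp only [Finset.card_univ, Fintype.card_fin]
    omega
  · intro p p' c' h2 h3
    have := gap_spec p' c'
    have := gap_spec p c'
    have := c'.2
    have := p.2
    have := p'.2
    have := cpred_spec c'
    have := cpred_spec p
    have := cpred_spec (cpred p)
    have := cpred_spec (cpred (cpred p))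
    have := cpred_spec (cpred (cpred (cpred p)))
    split_ifs
    · simp only [Finset.inl_mem_disjSum, Finset.mem_insert, Finset.mem_singleton, Fin.ext_iff]
      omega
    · simp only [Finset.inl_mem_disjSum, Finset.mem_insert, Finset.mem_singleton, Fin.ext_iff]
      omega
    · simp

/-- With t = K - L + 1 dividing K, residues modulo t respect the cycle, and a user misses only
caches of other residues. Coloring by unordered pairs of distinct residues uses t(t - 1)/2 = m
colors overall. Between interfering nodes a swapped pair would give the user the residue of a cache
it misses, and an unswapped one forces equal gaps, hence equal nodes. -/
theorem hasTightColoring_of_dvd {K L : ℕ} (hL : 1 ≤ L) (hLK : L ≤ K) (h : K - L + 1 ∣ K) :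
    HasTightColoring K L := by
  classical
  set t := K - L + 1 with ht
  have hKt : (K : ZMod t) = 0 := (ZMod.natCast_eq_zero_iff K t).2 h
  have hcast : ∀ p c : Fin K, ((p : ℕ) : ZMod t) = (c : ℕ) + gap p c := fun p c => by
    rcases (gap_spec p c).2 with h | h
    · exact_mod_cast congrArg (Nat.cast (R := ZMod t)) h
    · have := congrArg (Nat.cast (R := ZMod t)) h
      push_cast at this
      rwa [hKt, add_zero] at this
  have hinj : ∀ i j : ℕ, i < t → j < t → (i : ZMod t) = j → i = j := fun i j hi hj hij => by
    have := (ZMod.natCast_eq_natCast_iff' i j t).1 hij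
    rwa [Nat.mod_eq_of_lt hi, Nat.mod_eq_of_lt hj] at this
  have hne : ∀ p c : Fin K, gap p c ≤ K - L → ((p : ℕ) : ZMod t) ≠ (c : ℕ) := fun p c hg heq => by
    have h0 := hcast p c
    rw [heq, left_eq_add] at h0
    have := hinj (gap p c) 0 (by omega) (by omega) (by simpa using h0)
    have := gap_spec p c
    omega
  refine hasTightColoring_of_gap (C := Sym2 (ZMod t)) hL hLK
    (fun p c => s(((p : ℕ) : ZMod t), ((c : ℕ) : ZMod t))) ?_
    (fun _ => Finset.univ.filter fun a => ¬ a.IsDiag) ?_ ?_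
  · intro p c p' c' h1 h2 h3 heq
    rcases Sym2.eq_iff.1 heq with ⟨e1, e2⟩ | ⟨e1, -⟩
    · have g1 : gap p c = gap p c' := by
        refine hinj _ _ (by omega) (by omega) ?_
        have := (hcast p c).symm.trans (hcast p c')
        rwa [e2, add_right_inj] at this
      have g2 : gap p c = gap p' c' := by
        refine hinj _ _ (by omega) (by omega) ?_
        have := (hcast p c).symm.trans (e1.trans (hcast p' c'))
        rwa [e2, add_right_inj] at this
      have := gap_spec p c
      have := gap_spec p' c'
      have := gap_spec p c'
      have := c.2
      have := c'.2
      have := p.2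
      have := p'.2
      rw [Fin.ext_iff, Fin.ext_iff]
      omega
    · exact (hne _ _ h3 e1).elim
  · intro _
    rw [← Fintype.card_subtype, Sym2.card_subtype_not_diag, ZMod.card, Nat.choose_two_right, ht,
      Nat.add_sub_cancel, mul_comm]
  · intro p p' c' h2 h3
    simpa using hne _ _ h2

end MultiaccessCaching

open MultiaccessCaching in
theorem theorem3 (N K L : ℕ) (hKN : K ≤ N) (hL : 1 ≤ L) (hLK : L ≤ K) (hKL : (K : ℝ) / 2 ≤ L)
    (hcase : L + 1 = K ∨ L + 2 = K ∨ (L + 3 = K ∧ Even K) ∨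
      ∃ s : ℕ, 0 < s ∧ (L : ℝ) = (K : ℝ) - (K : ℝ) / s + 1) :
    (∀ M : ℝ, 0 ≤ M →
      IsLeast {R : ℝ | Achievable N K L R M} (optimalRate N K L M) ∧
      optimalRate N K L M = rateLb N K L M) ∧
    (deliveryICP K L).localChromaticNumber = (K - L) * (K - L + 1) / 2 := by
  have hK2 : K ≤ 2 * L := by
    have : (K : ℝ) ≤ 2 * L := by linarith
    exact_mod_cast this
  have hcol : HasTightColoring K L := by
    rcases hcase with h | h | ⟨h, hK⟩ | ⟨s, hs, h⟩
    · exact hasTightColoring_one hL h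
    · exact hasTightColoring_two (by omega) h
    · exact hasTightColoring_three (by omega) h hK
    -- The fourth case says K = (K - L + 1)s.
    · refine hasTightColoring_of_dvd hL hLK ⟨s, ?_⟩
      have hsR : (s : ℝ) ≠ 0 := by exact_mod_cast hs.ne'
      have : (K : ℝ) = ((K - L : ℕ) + 1) * s := by
        rw [Nat.cast_sub hLK, h]
        field_simp
        ring
      exact_mod_cast this
  obtain ⟨C, _, _, col, hproper, hloc⟩ := hcol
  refine ⟨fun M hM => ?_, localChromaticNumber_eq hL hLK hproper hloc⟩
  have hleast : IsLeast {R : ℝ | Achievable N K L R M} (rateLb N K L M) :=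
    ⟨achievable_rateLb hKN hL hLK hK2 hproper hloc hM, fun _ h => rateLb_le hKN hL hLK h⟩
  have heq : optimalRate N K L M = rateLb N K L M := hleast.csInf_eq
  exact ⟨heq ▸ hleast, heq⟩
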